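/- All manifolds are smooth, Hausdorff, second countable and connected, and all tensor fields are $C^\infty$. An almost contact metric structure on a $(2n+1)$-dimensional manifold $M$ is a quadruple $(\varphi,\xi,\eta,g)$, with $\varphi$ a $(1,1)$-tensor field, $\xi$ a vector field, $\eta$ a $1$-form and $g$ a Riemannian metric, such that $\varphi^2=-I+\eta\otimes\xi$, $\eta(\xi)=1$, $\eta\circ\varphi=0$, $\varphi(\xi)=0$, $\eta(X)=g(X,\xi)$ and $g(\varphi X,\varphi Y)=g(X,Y)-\eta(X)\eta(Y)$. Let $\nabla$ be the Levi-Civita connection of $g$. For a strictly positive $f\in C^\infty(M)$ with $df\wedge\eta=0$, the manifold is called $f$-Kenmotsu if $(\nabla_X\varphi)(Y)=f\,(g(\varphi X,Y)\xi-\eta(Y)\varphi X)$ for all vector fields $X,Y$, and it is called regular if moreover $f^2+\xi(f)$ vanishes nowhere. A quadratic first integral of the geodesics is a function $F(v)=a(v,v)$ on $TM$, where $a$ is a symmetric $(0,2)$-tensor field with $a_{ij:k}+a_{jk:i}+a_{ki:j}=0$ (covariant derivatives with respect to $\nabla$); it is special (an SQFI) if $\nabla a=0$. Put $M_S(2n+1)=1+n(2n-1)$.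 Proposition 5. (i) For every $n\ge 1$ there exist almost contact metric manifolds of dimension $2n+1$, namely regular $f$-Kenmotsu manifolds, which do not admit $M_S(2n+1)$ linearly independent SQFI. (ii) On every regular $f$-Kenmotsu manifold of dimension $2n+1$, the SQFI are exactly the constant multiples of the kinetic energy $v\mapsto g(v,v)$. Hence the maximal number of linearly independent SQFI is exactly $1$, and for $n\ge1$ no such manifold admits $M_S(2n+1)$ linearly independent SQFI. -/

import Mathlib

open Bundle
open scoped Manifold ContDiff

noncomputable section

namespace AlmostContact

/-- The model space `ℝᵐ`. -/
abbrev Model (m : ℕ) : Type := EuclideanSpace ℝ (Fin m)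

/-- The tangent space at a point of an `m`-dimensional manifold. -/
abbrev Tan (m : ℕ) {M : Type*} [TopologicalSpace M] [ChartedSpace (Model m) M] (x : M) : Type :=
  TangentSpace (𝓡 m) x

section Tensors

variable {m : ℕ} {M : Type*} [TopologicalSpace M] [ChartedSpace (Model m) M]

/-- A function on `M` is smooth. -/
def SmoothFunction (f : M → ℝ) : Prop := ContMDiff (𝓡 m) 𝓘(ℝ, ℝ) ∞ f

variable [IsManifold (𝓡 m) ∞ M]

/-- A vector field is differentiable at the point `x`. -/
def DiffAt (X : (x : M) → Tan m x) (x : M) : Prop :=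
  MDifferentiableAt (𝓡 m) ((𝓡 m).prod 𝓘(ℝ, Model m))
    (fun y ↦ TotalSpace.mk' (Model m) (E := fun y : M ↦ Tan m y) y (X y)) x

/-- A vector field is smooth. -/
def SmoothVectorField (X : (x : M) → Tan m x) : Prop :=
  ContMDiff (𝓡 m) ((𝓡 m).prod 𝓘(ℝ, Model m)) ∞
    (fun x ↦ TotalSpace.mk' (Model m) (E := fun x : M ↦ Tan m x) x (X x))

/-- A `1`-form is smooth. -/
def SmoothOneForm (η : (x : M) → Tan m x →L[ℝ] ℝ) : Prop :=
  ContMDiff (𝓡 m) ((𝓡 m).prod 𝓘(ℝ, Model m →L[ℝ] ℝ)) ∞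
    (fun x ↦ TotalSpace.mk' (Model m →L[ℝ] ℝ) (E := fun x : M ↦ (Tan m x →L[ℝ] ℝ)) x (η x))

/-- A tensor field of type `(1,1)` is smooth. -/
def SmoothEndomorphism (φ : (x : M) → Tan m x →L[ℝ] Tan m x) : Prop :=
  ContMDiff (𝓡 m) ((𝓡 m).prod 𝓘(ℝ, Model m →L[ℝ] Model m)) ∞
    (fun x ↦ TotalSpace.mk' (Model m →L[ℝ] Model m)
      (E := fun x : M ↦ (Tan m x →L[ℝ] Tan m x)) x (φ x))

/-- A tensor field of type `(0,2)` is smooth. -/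
def SmoothTwoTensor (a : (x : M) → Tan m x →L[ℝ] Tan m x →L[ℝ] ℝ) : Prop :=
  ContMDiff (𝓡 m) ((𝓡 m).prod 𝓘(ℝ, Model m →L[ℝ] Model m →L[ℝ] ℝ)) ∞
    (fun x ↦ TotalSpace.mk' (Model m →L[ℝ] Model m →L[ℝ] ℝ)
      (E := fun x : M ↦ (Tan m x →L[ℝ] Tan m x →L[ℝ] ℝ)) x (a x))

/-- A tensor field of type `(0,2)` is symmetric. -/
def SymmetricTwoTensor (a : (x : M) → Tan m x →L[ℝ] Tan m x →L[ℝ] ℝ) : Prop :=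
  ∀ (x : M) (v w : Tan m x), a x v w = a x w v

end Tensors

section Connections

variable (m : ℕ) (M : Type*) [TopologicalSpace M] [ChartedSpace (Model m) M]
  [IsManifold (𝓡 m) ∞ M]

/-- Linear connections on (the tangent bundle of) `M`. For such a `D`, the vector `D Y x v` is
`∇_v Y` at the point `x`. -/
abbrev Connection : Type _ :=
  CovariantDerivative (𝓡 m) (Model m) (fun x : M ↦ TangentSpace (𝓡 m) x)

/-- Smooth Riemannian metrics on `M`. -/
abbrev Metric : Type _ :=
  ContMDiffRiemannianMetric (𝓡 m) ∞ (Model m) (fun x : M ↦ TangentSpace (𝓡 m) x)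

variable {m M}

/-- `D` is the Levi-Civita connection of `g`: it is torsion-free and compatible with `g`. -/
def IsLeviCivita (D : Connection m M) (g : Metric m M) : Prop :=
  D.torsion = 0 ∧
    (letI : RiemannianBundle (fun x : M ↦ TangentSpace (𝓡 m) x) := ⟨g.toRiemannianMetric⟩
     CovariantDerivative.IsMetricCompatible D)

/-- `(∇_v φ)(Y) = ∇_v (φ Y) - φ (∇_v Y)` at the point `x`, for a `(1,1)`-tensor field `φ`. -/
def nablaEndomorphism (D : Connection m M) (φ : (x : M) → Tan m x →L[ℝ] Tan m x)
    (x : M) (v : Tan m x) (Y : (x : M) → Tan m x) : Tan m x :=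
  D (fun y ↦ φ y (Y y)) x v - φ x (D Y x v)

/-- `(∇_v a)(Y, Z) = v (a (Y, Z)) - a (∇_v Y, Z) - a (Y, ∇_v Z)` at the point `x`, for a
`(0,2)`-tensor field `a`. -/
def nablaTwoTensor (D : Connection m M) (a : (x : M) → Tan m x →L[ℝ] Tan m x →L[ℝ] ℝ)
    (x : M) (v : Tan m x) (Y Z : (x : M) → Tan m x) : ℝ :=
  mvfderiv (𝓡 m) (fun y ↦ a y (Y y) (Z y)) x v
    - a x (D Y x v) (Z x) - a x (Y x) (D Z x v)

/-- The Killing-type equations for a `(0,2)`-tensor field: the cyclic sum of `∇a` vanishes. -/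
def KillingType (D : Connection m M) (a : (x : M) → Tan m x →L[ℝ] Tan m x →L[ℝ] ℝ) : Prop :=
  ∀ (x : M) (X Y Z : (x : M) → Tan m x), DiffAt X x → DiffAt Y x → DiffAt Z x →
    nablaTwoTensor D a x (Z x) X Y + nablaTwoTensor D a x (X x) Y Z
      + nablaTwoTensor D a x (Y x) Z X = 0

/-- The `(0,2)`-tensor field `a` is parallel: `∇a = 0`. -/
def Parallel (D : Connection m M) (a : (x : M) → Tan m x →L[ℝ] Tan m x →L[ℝ] ℝ) : Prop :=
  ∀ (x : M) (v : Tan m x) (Y Z : (x : M) → Tan m x), DiffAt Y x → DiffAt Z x →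
    nablaTwoTensor D a x v Y Z = 0

/-- The function `v ↦ a (v, v)` on the tangent bundle attached to a `(0,2)`-tensor field. -/
def quadraticFunction (a : (x : M) → Tan m x →L[ℝ] Tan m x →L[ℝ] ℝ) :
    TangentBundle (𝓡 m) M → ℝ :=
  fun p ↦ a p.1 p.2 p.2

/-- `a` is a symmetric smooth tensor field satisfying the Killing-type equations, that is, it
defines a quadratic first integral of the geodesics. -/
structure DefinesQFI (D : Connection m M)
    (a : (x : M) → Tan m x →L[ℝ] Tan m x →L[ℝ] ℝ) : Prop where
  smooth : SmoothTwoTensor a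
  symm : SymmetricTwoTensor a
  killing : KillingType D a

/-- `F` is a special quadratic first integral of the geodesics of `D`: a quadratic first integral
whose tensor field is parallel. -/
def IsSQFI (D : Connection m M) (F : TangentBundle (𝓡 m) M → ℝ) : Prop :=
  ∃ a : (x : M) → Tan m x →L[ℝ] Tan m x →L[ℝ] ℝ,
    DefinesQFI D a ∧ Parallel D a ∧ F = quadraticFunction a

/-- There are `N` linearly independent special quadratic first integrals. -/
def AdmitsSQFI (D : Connection m M) (N : ℕ) : Prop :=
  ∃ F : Fin N → (TangentBundle (𝓡 m) M → ℝ), (∀ i, IsSQFI D (F i)) ∧ LinearIndependent ℝ F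

/-- The kinetic energy `g_{ij} ẋⁱ ẋʲ`. -/
def kineticEnergy (g : Metric m M) : TangentBundle (𝓡 m) M → ℝ := quadraticFunction g.inner

end Connections

section Structures

/-- Almost contact metric structures `(φ, ξ, η, g)` on the `m`-dimensional manifold `M`. -/
structure AlmostContactMetric (m : ℕ) (M : Type*) [TopologicalSpace M] [ChartedSpace (Model m) M]
    [IsManifold (𝓡 m) ∞ M] where
  φ : (x : M) → Tan m x →L[ℝ] Tan m x
  ξ : (x : M) → Tan m x
  η : (x : M) → Tan m x →L[ℝ] ℝ
  g : Metric m M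
  smooth_φ : SmoothEndomorphism φ
  smooth_ξ : SmoothVectorField ξ
  smooth_η : SmoothOneForm η
  φ_sq : ∀ (x : M) (v : Tan m x), φ x (φ x v) = -v + η x v • ξ x
  η_ξ : ∀ x : M, η x (ξ x) = 1
  η_φ : ∀ (x : M) (v : Tan m x), η x (φ x v) = 0
  φ_ξ : ∀ x : M, φ x (ξ x) = 0
  η_eq : ∀ (x : M) (v : Tan m x), η x v = g.inner x v (ξ x)
  g_φ : ∀ (x : M) (v w : Tan m x),
    g.inner x (φ x v) (φ x w) = g.inner x v w - η x v * η x w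

variable {m : ℕ} {M : Type*} [TopologicalSpace M] [ChartedSpace (Model m) M]
  [IsManifold (𝓡 m) ∞ M]

/-- `(M, φ, ξ, η, g)`, with Levi-Civita connection `D`, is an `f`-Kenmotsu manifold. -/
structure IsFKenmotsu (S : AlmostContactMetric m M) (D : Connection m M) (f : M → ℝ) : Prop where
  leviCivita : IsLeviCivita D S.g
  smooth : SmoothFunction (m := m) f
  pos : ∀ x, 0 < f x
  wedge : ∀ (x : M) (v w : Tan m x),
    mvfderiv (𝓡 m) f x v * S.η x w - mvfderiv (𝓡 m) f x w * S.η x v = 0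
  nabla_φ : ∀ (x : M) (v : Tan m x) (Y : (x : M) → Tan m x), DiffAt Y x →
    nablaEndomorphism D S.φ x v Y
      = f x • (S.g.inner x (S.φ x v) (Y x) • S.ξ x - S.η x (Y x) • S.φ x v)

/-- A regular `f`-Kenmotsu manifold: `f² + ξ(f)` has no zero. -/
def IsRegularFKenmotsu (S : AlmostContactMetric m M) (D : Connection m M) (f : M → ℝ) : Prop :=
  IsFKenmotsu S D f ∧ ∀ x : M, f x ^ 2 + mvfderiv (𝓡 m) f x (S.ξ x) ≠ 0

end Structures

end AlmostContact

end

/-! Let `a` be parallel and symmetric, and put h = a(ξ,ξ). The Kenmotsu condition at Y = ξ gives ∇_v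
ξ = f(v - η(v)ξ), hence dh = 2fβ with β(v) = a(v,ξ) - η(v)h. Since β(ξ) = 0 and ∇_ξ ξ = 0, one has
ξh = 0 and ∇_ξ β = 0. Evaluating [ξ,Y]h = ξ(Yh) - Y(ξh) then yields (f² + ξf)β = 0, so regularity
forces β = 0 (`IsRegularFKenmotsu.apply_ξ`). This replaces a curvature computation by the symmetry
of second derivatives of one function.

Now dh = 0, so h is a constant c on the connected manifold and a(·,ξ) = cη. Differentiating this
once more gives f(a - cg) = 0, and f > 0 gives a = cg (`IsRegularFKenmotsu.eq_smul_metric`). The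
SQFI thus form a line, while 1 + n(2n-1) > 1 for n ≥ 1.

For existence, hyperbolic space serves: ℝ × ℝ²ⁿ with metric dt² + e^{2t}g₀, whose parallel complex
structure on the flat factor makes it f-Kenmotsu with f = 1. -/

/-! ### The Lie bracket as a commutator of derivations. -/

section LieBracketDerivation

open VectorField Filter Topology

variable {E : Type*} [NormedAddCommGroup E] [NormedSpace ℝ E] [CompleteSpace E]
  {H : Type*} [TopologicalSpace H] {I : ModelWithCorners ℝ E H}
  {M : Type*} [TopologicalSpace M] [ChartedSpace H M] [IsManifold I ∞ M]

/-- An outer bracket differentiates the inner one, so the product rule is needed on a neighbourhood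
and not only at the point. -/
lemma mlieBracket_smul_right_eventuallyEq {h : M → ℝ} {Y Z : (x : M) → TangentSpace I x} {x : M}
    (hh : CMDiffAt ∞ h x) (hZ : CMDiffAt ∞ (T% Z) x) :
    mlieBracket I Y (h • Z) =ᶠ[𝓝 x]
      (fun y ↦ mvfderiv I h y (Y y)) • Z + h • mlieBracket I Y Z := by
  have hh1 : CMDiffAt 1 h x := hh.of_le ENat.LEInfty.out
  have hZ1 : CMDiffAt 1 (T% Z) x := hZ.of_le ENat.LEInfty.out
  filter_upwards [(contMDiffAt_iff_contMDiffAt_nhds (by simp)).1 hh1,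
    (contMDiffAt_iff_contMDiffAt_nhds (by simp)).1 hZ1] with y hy hZy
  exact mlieBracket_smul_right (hy.mdifferentiableAt one_ne_zero)
    (hZy.mdifferentiableAt one_ne_zero)

/-- The Lie bracket acts on functions as the commutator of derivations. -/
lemma mvfderiv_mlieBracket {h : M → ℝ} {X Y Z : (x : M) → TangentSpace I x} {x : M}
    (hh : CMDiffAt ∞ h x) (hX : CMDiffAt ∞ (T% X) x) (hY : CMDiffAt ∞ (T% Y) x)
    (hZ : CMDiffAt ∞ (T% Z) x) (hZx : Z x ≠ 0)
    (hXh : MDiffAt (fun y ↦ mvfderiv I h y (X y)) x)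
    (hYh : MDiffAt (fun y ↦ mvfderiv I h y (Y y)) x) :
    mvfderiv I h x (mlieBracket I X Y x) =
      mvfderiv I (fun y ↦ mvfderiv I h y (Y y)) x (X x) -
        mvfderiv I (fun y ↦ mvfderiv I h y (X y)) x (Y x) := by
  have hdiff {W : (x : M) → TangentSpace I x} (hW : CMDiffAt ∞ (T% W) x) : MDiffAt (T% W) x :=
    hW.mdifferentiableAt (by simp)
  have hhd : MDiffAt h x := hh.mdifferentiableAt (by simp)
  have : IsManifold I (((2 : ℕ∞) : ℕ∞ω) + 1) M := IsManifold.of_le (n := ∞) (by exact_mod_cast le_top)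
  have : IsManifold I (minSmoothness ℝ 3) M := by
    simp only [minSmoothness_of_isRCLikeNormedField]
    infer_instance
  have : IsManifold I (minSmoothness ℝ 2) M := by
    simp only [minSmoothness_of_isRCLikeNormedField]
    infer_instance
  have hle : ((2 : ℕ∞) : ℕ∞ω) ≤ ∞ := by exact_mod_cast le_top
  have hbr {W : (x : M) → TangentSpace I x} (hW : CMDiffAt ∞ (T% W) x) :
      MDiffAt (T% (mlieBracket I W Z)) x :=
    (ContMDiffAt.mlieBracket_vectorField (m := 1) (n := 2) (hW.of_le hle)
      (hZ.of_le hle) (by simp; norm_num)).mdifferentiableAt (by simp)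
  -- The product rule applied twice to [V, [W, hZ]].
  have key {W : (x : M) → TangentSpace I x} (V : (x : M) → TangentSpace I x)
      (hW : CMDiffAt ∞ (T% W) x) (hWh : MDiffAt (fun y ↦ mvfderiv I h y (W y)) x) :
      mlieBracket I V (mlieBracket I W (h • Z)) x =
        mvfderiv I (fun y ↦ mvfderiv I h y (W y)) x (V x) • Z x
        + mvfderiv I h x (W x) • mlieBracket I V Z x
        + (mvfderiv I h x (V x) • mlieBracket I W Z x
        + h x • mlieBracket I V (mlieBracket I W Z) x) := by
    rw [EventuallyEq.rfl.mlieBracket_vectorField_eq (mlieBracket_smul_right_eventuallyEq hh hZ),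
      mlieBracket_add_right, mlieBracket_smul_right hWh (hdiff hZ),
      mlieBracket_smul_right hhd (hbr hW)]
    · exact hWh.smul_section (hdiff hZ)
    · exact hhd.smul_section (hbr hW)
  have hsm : CMDiffAt ∞ (T% (h • Z)) x := hh.smul_section hZ
  have h2 : minSmoothness ℝ 2 ≤ ∞ := by
    simp only [minSmoothness_of_isRCLikeNormedField]; exact hle
  have J := leibniz_identity_mlieBracket_apply (hX.of_le h2) (hY.of_le h2) (hsm.of_le h2)
  have J' := leibniz_identity_mlieBracket_apply (hX.of_le h2) (hY.of_le h2) (hZ.of_le h2)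
  rw [key X hY hYh, key Y hX hXh, mlieBracket_smul_right hhd (hdiff hZ), J'] at J
  -- In the Jacobi identity for hZ the mixed first-order terms cancel by symmetry and the
  -- h-multiples by the Jacobi identity for Z; what is left is a scalar times Z x ≠ 0.
  have e : (mvfderiv I h x (mlieBracket I X Y x) -
      (mvfderiv I (fun y ↦ mvfderiv I h y (Y y)) x (X x) -
        mvfderiv I (fun y ↦ mvfderiv I h y (X y)) x (Y x))) • Z x = 0 := by
    linear_combination (norm := module) (-1 : ℝ) • J
  exact sub_eq_zero.1 ((smul_eq_zero.1 e).resolve_right hZx)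

end LieBracketDerivation

/-! ### Functions with zero derivative. -/

section LocallyConstant

open Topology

variable {E : Type*} [NormedAddCommGroup E] [NormedSpace ℝ E]
  {H : Type*} [TopologicalSpace H] {I : ModelWithCorners ℝ E H} [I.Boundaryless]
  {M : Type*} [TopologicalSpace M] [ChartedSpace H M] [IsManifold I 1 M]

/-- A function whose derivative vanishes identically is locally constant. -/
lemma isLocallyConstant_of_mvfderiv_eq_zero {h : M → ℝ} (hh : MDiff h)
    (h0 : ∀ x, mvfderiv I h x = 0) : IsLocallyConstant h := by
  refine (IsLocallyConstant.iff_exists_open h).2 fun x ↦ ?_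
  have hm : ∀ z ∈ (extChartAt I x).target, MDiffAt (extChartAt I x).symm z := fun z hz ↦
    (contMDiffOn_extChartAt_symm (n := 1) x).contMDiffAt
      ((isOpen_extChartAt_target x).mem_nhds hz) |>.mdifferentiableAt one_ne_zero
  have hd : DifferentiableOn ℝ (h ∘ (extChartAt I x).symm) (extChartAt I x).target := fun z hz ↦
    ((hh _).comp z (hm z hz)).differentiableAt.differentiableWithinAt
  have hf : (extChartAt I x).target.EqOn (fderiv ℝ (h ∘ (extChartAt I x).symm)) 0 := fun z hz ↦ by
    ext v
    have := mvfderiv_comp_apply z (hh _) (hm z hz) v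
    rw [h0, zero_apply] at this
    rw [← mfderiv_eq_fderiv]
    exact this
  have ho := (isOpen_extChartAt_target (I := I) x).isOpen_inter_preimage_of_fderiv_eq_zero hd hf
    {h x}
  refine ⟨(extChartAt I x).source ∩ extChartAt I x ⁻¹' ((extChartAt I x).target ∩
    (h ∘ (extChartAt I x).symm) ⁻¹' {h x}), isOpen_extChartAt_preimage' x ho, ?_, ?_⟩
  · simp
  · rintro y ⟨hy, -, hy'⟩
    rwa [Set.mem_preimage, Function.comp_apply, (extChartAt I x).left_inv hy] at hy'

end LocallyConstant

namespace AlmostContact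

open VectorField Filter Topology

variable {m : ℕ} {M : Type*} [TopologicalSpace M] [ChartedSpace (Model m) M]
  [IsManifold (𝓡 m) ∞ M]

/-! ### Product rules for parallel tensors and the Levi-Civita connection. -/

section

variable {D : Connection m M} {g : Metric m M}

lemma SmoothVectorField.diffAt {X : (x : M) → Tan m x} (hX : SmoothVectorField X) (x : M) :
    DiffAt X x :=
  (hX x).mdifferentiableAt (by simp)

/-- Every tangent vector extends to a vector field that is smooth near its base point. -/
lemma exists_contMDiffAt_extension {x : M} (v : Tan m x) :
    ∃ X : (x : M) → Tan m x, X x = v ∧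
      ContMDiffAt (𝓡 m) ((𝓡 m).prod 𝓘(ℝ, Model m)) ∞
        (fun x ↦ TotalSpace.mk' (Model m) (E := fun x : M ↦ TangentSpace (𝓡 m) x) x (X x)) x :=
  ⟨FiberBundle.extend (Model m) (E := fun x : M ↦ TangentSpace (𝓡 m) x) v, by simp,
    FiberBundle.contMDiffAt_extend (𝓡 m) (Model m) (V := fun x : M ↦ TangentSpace (𝓡 m) x) v⟩

lemma SmoothTwoTensor.mdifferentiableAt {a : (x : M) → Tan m x →L[ℝ] Tan m x →L[ℝ] ℝ}
    (ha : SmoothTwoTensor a) {Y Z : (x : M) → Tan m x} {x : M} (hY : DiffAt Y x)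
    (hZ : DiffAt Z x) : MDifferentiableAt (𝓡 m) 𝓘(ℝ, ℝ) (fun y ↦ a y (Y y) (Z y)) x := by
  have h := MDifferentiableAt.clm_bundle_apply₂ (F₁ := Model m) (F₂ := Model m) (F₃ := ℝ)
    (E₁ := fun x : M ↦ TangentSpace (𝓡 m) x) (E₂ := fun x : M ↦ TangentSpace (𝓡 m) x)
    (E₃ := Bundle.Trivial M ℝ) ((ha x).mdifferentiableAt (by simp)) hY hZ
  exact ((mdifferentiableAt_totalSpace ..).1 h).2

lemma SmoothTwoTensor.contMDiff {a : (x : M) → Tan m x →L[ℝ] Tan m x →L[ℝ] ℝ}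
    (ha : SmoothTwoTensor a) {Y Z : (x : M) → Tan m x} (hY : SmoothVectorField Y)
    (hZ : SmoothVectorField Z) : SmoothFunction (m := m) (fun y ↦ a y (Y y) (Z y)) := by
  have h := ContMDiff.clm_bundle_apply₂ (F₁ := Model m) (F₂ := Model m) (F₃ := ℝ)
    (E₁ := fun x : M ↦ TangentSpace (𝓡 m) x) (E₂ := fun x : M ↦ TangentSpace (𝓡 m) x)
    (E₃ := Bundle.Trivial M ℝ) ha hY hZ
  exact fun x ↦ (contMDiffAt_totalSpace.1 (h x)).2

lemma Metric.smooth (g : Metric m M) : SmoothTwoTensor g.inner := g.contMDiff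

lemma Parallel.mvfderiv_eq {a : (x : M) → Tan m x →L[ℝ] Tan m x →L[ℝ] ℝ} (ha : Parallel D a)
    {x : M} (v : Tan m x) {Y Z : (x : M) → Tan m x} (hY : DiffAt Y x) (hZ : DiffAt Z x) :
    mvfderiv (𝓡 m) (fun y ↦ a y (Y y) (Z y)) x v
      = a x (D Y x v) (Z x) + a x (Y x) (D Z x v) := by
  have := ha x v Y Z hY hZ
  rw [nablaTwoTensor] at this
  linarith

/-- Puts the metric on the same footing as `a`, so that one product rule serves both. -/
lemma IsLeviCivita.parallel (h : IsLeviCivita D g) : Parallel D g.inner := by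
  intro x v Y Z hY hZ
  let : RiemannianBundle (fun x : M ↦ TangentSpace (𝓡 m) x) := ⟨g.toRiemannianMetric⟩
  obtain ⟨X, rfl, -⟩ := exists_contMDiffAt_extension v
  have := h.2.mvfderiv_inner_eq X hY hZ
  rw [nablaTwoTensor, sub_sub, sub_eq_zero]
  exact this

lemma IsLeviCivita.torsion (h : IsLeviCivita D g) {X Y : (x : M) → Tan m x} {x : M}
    (hX : DiffAt X x) (hY : DiffAt Y x) :
    D Y x (X x) - D X x (Y x) = mlieBracket (𝓡 m) X Y x :=
  (CovariantDerivative.torsion_eq_zero_iff D).1 h.1 hX hY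

end

variable {m : ℕ} {M : Type*} [TopologicalSpace M] [ChartedSpace (Model m) M]
  [IsManifold (𝓡 m) ∞ M]

/-! ### Rigidity of parallel symmetric tensors on regular f-Kenmotsu manifolds. -/

section Kenmotsu

variable {S : AlmostContactMetric m M} {D : Connection m M} {f : M → ℝ}

lemma AlmostContactMetric.inner_ξ_ξ (S : AlmostContactMetric m M) (x : M) :
    S.g.inner x (S.ξ x) (S.ξ x) = 1 := by
  rw [← S.η_eq, S.η_ξ]

lemma AlmostContactMetric.ξ_ne_zero (S : AlmostContactMetric m M) (x : M) : S.ξ x ≠ 0 := by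
  intro h
  simpa [h] using S.η_ξ x

/-- Differentiate g(ξ,ξ) = 1. -/
lemma IsLeviCivita.η_nabla_ξ (h : IsLeviCivita D S.g) (x : M) (v : Tan m x) :
    S.η x (D S.ξ x v) = 0 := by
  have hξ := S.smooth_ξ.diffAt x
  have key := h.parallel.mvfderiv_eq v hξ hξ
  simp only [S.inner_ξ_ξ, mvfderiv_const] at key
  rw [S.g.symm x (S.ξ x), ← S.η_eq] at key
  simp only [zero_apply] at key
  linarith

lemma IsLeviCivita.mvfderiv_η (h : IsLeviCivita D S.g) {x : M} (v : Tan m x)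
    {Y : (x : M) → Tan m x} (hY : DiffAt Y x) :
    mvfderiv (𝓡 m) (fun y ↦ S.η y (Y y)) x v =
      S.η x (D Y x v) + S.g.inner x (Y x) (D S.ξ x v) := by
  simp only [S.η_eq]
  exact h.parallel.mvfderiv_eq v hY (S.smooth_ξ.diffAt x)

/-- On an `f`-Kenmotsu manifold, `∇_v ξ = f (v - η(v) ξ)`. -/
lemma IsFKenmotsu.nabla_ξ (h : IsFKenmotsu S D f) (x : M) (v : Tan m x) :
    D S.ξ x v = f x • (v - S.η x v • S.ξ x) := by
  have key := h.nabla_φ x v S.ξ (S.smooth_ξ.diffAt x)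
  have h0 : (fun y ↦ S.φ y (S.ξ y)) = 0 := funext S.φ_ξ
  have hφ : S.φ x (D S.ξ x v) = f x • S.φ x v := by
    rw [nablaEndomorphism, h0, CovariantDerivative.zero, ← S.η_eq, S.η_φ, S.η_ξ] at key
    simpa using key
  -- A second φ recovers ∇_v ξ up to its η-component, which vanishes because ξ has unit length.
  have h2 := S.φ_sq x (D S.ξ x v)
  rw [hφ, map_smul, S.φ_sq, h.leviCivita.η_nabla_ξ, zero_smul, add_zero] at h2
  rw [← neg_eq_iff_eq_neg] at h2
  rw [← h2]
  module

variable {a : (x : M) → Tan m x →L[ℝ] Tan m x →L[ℝ] ℝ}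

lemma IsFKenmotsu.nabla_ξ_ξ (h : IsFKenmotsu S D f) (x : M) : D S.ξ x (S.ξ x) = 0 := by
  rw [h.nabla_ξ, S.η_ξ, one_smul, sub_self, smul_zero]

/-- The derivative of `a(ξ, ξ)` for a parallel symmetric tensor field `a`. -/
lemma IsFKenmotsu.mvfderiv_apply_ξ_ξ (h : IsFKenmotsu S D f) (hs : SymmetricTwoTensor a)
    (ha : Parallel D a) (x : M) (v : Tan m x) :
    mvfderiv (𝓡 m) (fun y ↦ a y (S.ξ y) (S.ξ y)) x v =
      2 * f x * (a x v (S.ξ x) - S.η x v * a x (S.ξ x) (S.ξ x)) := by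
  have hξ := S.smooth_ξ.diffAt x
  rw [ha.mvfderiv_eq v hξ hξ, hs x (S.ξ x), h.nabla_ξ]
  simp only [map_smul, map_sub, smul_apply, sub_apply, smul_eq_mul]
  ring

/-- For a parallel symmetric tensor field `a` on a regular `f`-Kenmotsu manifold, `a(·, ξ)` is
proportional to `η`. -/
lemma IsRegularFKenmotsu.apply_ξ (h : IsRegularFKenmotsu S D f) (hsm : SmoothTwoTensor a)
    (hs : SymmetricTwoTensor a) (ha : Parallel D a) (x : M) (v : Tan m x) :
    a x v (S.ξ x) = S.η x v * a x (S.ξ x) (S.ξ x) := by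
  obtain ⟨hK, hreg⟩ := h
  obtain ⟨Y, rfl, hY⟩ := exists_contMDiffAt_extension v
  have hYd : DiffAt Y x := hY.mdifferentiableAt (by simp)
  have hξ := S.smooth_ξ.diffAt x
  have hh := hsm.contMDiff S.smooth_ξ S.smooth_ξ
  set h : M → ℝ := fun y ↦ a y (S.ξ y) (S.ξ y) with hdef
  have hd : ∀ y v, mvfderiv (𝓡 m) h y v = 2 * f y * (a y v (S.ξ y) - S.η y v * h y) :=
    hK.mvfderiv_apply_ξ_ξ hs ha
  have hdξ : (fun y ↦ mvfderiv (𝓡 m) h y (S.ξ y)) = fun _ ↦ 0 := by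
    funext y
    rw [hd, S.η_ξ, one_mul, sub_self, mul_zero]
  -- Writing η as g(·,ξ) lets the differentiability of two-tensors cover this term too.
  have hdY : (fun y ↦ mvfderiv (𝓡 m) h y (Y y)) =
      fun y ↦ 2 * f y * (a y (Y y) (S.ξ y) - S.g.inner y (Y y) (S.ξ y) * h y) := by
    funext y
    rw [hd, S.η_eq]
  have df : MDifferentiableAt (𝓡 m) 𝓘(ℝ, ℝ) f x := (hK.smooth x).mdifferentiableAt (by simp)
  have dh : MDifferentiableAt (𝓡 m) 𝓘(ℝ, ℝ) h x := (hh x).mdifferentiableAt (by simp)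
  have da := hsm.mdifferentiableAt hYd hξ
  have dg := S.g.smooth.mdifferentiableAt hYd hξ
  have d2 : MDifferentiableAt (𝓡 m) 𝓘(ℝ, ℝ) (fun y ↦ 2 * f y) x :=
    mdifferentiableAt_const.mul df
  have dgh : MDifferentiableAt (𝓡 m) 𝓘(ℝ, ℝ)
      (fun y ↦ S.g.inner y (Y y) (S.ξ y) * h y) x := dg.mul dh
  have dp : MDifferentiableAt (𝓡 m) 𝓘(ℝ, ℝ)
      (fun y ↦ a y (Y y) (S.ξ y) - S.g.inner y (Y y) (S.ξ y) * h y) x := da.sub dgh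
  have dY : MDifferentiableAt (𝓡 m) 𝓘(ℝ, ℝ) (fun y ↦ mvfderiv (𝓡 m) h y (Y y)) x := by
    rw [hdY]
    exact d2.mul dp
  -- The field ξ doubles as the auxiliary nonvanishing field.
  have hbr := mvfderiv_mlieBracket (hh x) (S.smooth_ξ x) hY (S.smooth_ξ x) (S.ξ_ne_zero x)
    (by rw [hdξ]; exact mdifferentiableAt_const) dY
  rw [hdξ, mvfderiv_const, hdY, mvfderiv_fun_mul d2 dp, mvfderiv_fun_sub da dgh,
    mvfderiv_fun_mul dg dh, mvfderiv_fun_mul mdifferentiableAt_const df, mvfderiv_const,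
    ← hK.leviCivita.torsion hξ hYd, map_sub, hd, hd, hK.nabla_ξ] at hbr
  simp only [add_apply, sub_apply, smul_apply, zero_apply, smul_eq_mul,
    ha.mvfderiv_eq (S.ξ x) hYd hξ, hK.leviCivita.mvfderiv_η (S.ξ x) hYd,
    hK.nabla_ξ_ξ, map_zero, map_smul, map_sub, S.η_ξ, ← S.η_eq, congrFun hdξ x] at hbr
  -- By zero torsion, [ξ,Y] = ∇_ξ Y - f(Y - η(Y)ξ). The terms 2fβ(∇_ξ Y) cancel, leaving -2f²β(Y) =
  -- 2ξ(f)β(Y).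
  have hfac : (f x ^ 2 + mvfderiv (𝓡 m) f x (S.ξ x)) *
      (a x (Y x) (S.ξ x) - S.η x (Y x) * a x (S.ξ x) (S.ξ x)) = 0 := by
    simp only [hdef] at hbr
    linear_combination -hbr / 2
  exact sub_eq_zero.1 ((mul_eq_zero.1 hfac).resolve_left (hreg x))

/-- A parallel symmetric tensor field on a regular `f`-Kenmotsu manifold is a constant multiple
of the metric. -/
theorem IsRegularFKenmotsu.eq_smul_metric [ConnectedSpace M] (h : IsRegularFKenmotsu S D f)
    (hsm : SmoothTwoTensor a) (hs : SymmetricTwoTensor a) (ha : Parallel D a) :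
    ∃ c : ℝ, ∀ (x : M) (v w : Tan m x), a x v w = c * S.g.inner x v w := by
  have hK := h.1
  have hh := hsm.contMDiff S.smooth_ξ S.smooth_ξ
  have hloc : IsLocallyConstant fun y ↦ a y (S.ξ y) (S.ξ y) := by
    refine isLocallyConstant_of_mvfderiv_eq_zero (I := 𝓡 m)
      (fun x ↦ (hh x).mdifferentiableAt (by simp)) fun x ↦ ?_
    ext v
    rw [hK.mvfderiv_apply_ξ_ξ hs ha, h.apply_ξ hsm hs ha]
    simp
  obtain ⟨x₀⟩ := (inferInstance : Nonempty M)
  set c := a x₀ (S.ξ x₀) (S.ξ x₀)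
  have hc : ∀ x, a x (S.ξ x) (S.ξ x) = c := fun x ↦ hloc.apply_eq_of_isPreconnected
    isPreconnected_univ (Set.mem_univ x) (Set.mem_univ x₀)
  have hη : ∀ x v, a x v (S.ξ x) = c * S.η x v := fun x v ↦ by
    rw [h.apply_ξ hsm hs ha, hc, mul_comm]
  refine ⟨c, fun x v w ↦ ?_⟩
  obtain ⟨Y, rfl, hY⟩ := exists_contMDiffAt_extension v
  have hYd : DiffAt Y x := hY.mdifferentiableAt (by simp)
  have hξ := S.smooth_ξ.diffAt x
  have key := ha.mvfderiv_eq w hYd hξ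
  have dη : MDifferentiableAt (𝓡 m) 𝓘(ℝ, ℝ) (fun y ↦ S.η y (Y y)) x := by
    simp only [S.η_eq]
    exact S.g.smooth.mdifferentiableAt hYd hξ
  simp only [hη] at key
  rw [mvfderiv_fun_mul mdifferentiableAt_const dη, mvfderiv_const] at key
  simp only [add_apply, smul_apply, zero_apply, smul_eq_mul, hK.leviCivita.mvfderiv_η w hYd,
    hK.nabla_ξ, map_smul, map_sub, hη, ← S.η_eq] at key
  -- Differentiating a(Y,ξ) = cη(Y) along w, the ∇_w Y terms cancel, as do those containing η(w).
  have : f x * (a x (Y x) w - c * S.g.inner x (Y x) w) = 0 := by linear_combination -key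
  exact sub_eq_zero.1 ((mul_eq_zero.1 this).resolve_left (hK.pos x).ne')

lemma Parallel.const_smul (ha : Parallel D a) (hsm : SmoothTwoTensor a) (c : ℝ) :
    Parallel D (fun x ↦ c • a x) := by
  intro x v Y Z hY hZ
  have key := ha.mvfderiv_eq v hY hZ
  have hd := hsm.mdifferentiableAt hY hZ
  simp only [nablaTwoTensor, smul_apply, smul_eq_mul]
  rw [mvfderiv_fun_mul mdifferentiableAt_const hd, mvfderiv_const]
  simp only [add_apply, smul_apply, zero_apply, smul_eq_mul, key]
  ring

lemma Parallel.killingType (ha : Parallel D a) : KillingType D a := by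
  intro x X Y Z hX hY hZ
  rw [ha x _ X Y hX hY, ha x _ Y Z hY hZ, ha x _ Z X hZ hX]
  simp

lemma SmoothTwoTensor.const_smul (ha : SmoothTwoTensor a) (c : ℝ) :
    SmoothTwoTensor (fun x ↦ c • a x) :=
  ContMDiff.const_smul_section (a := c) ha

/-- Constant multiples of the kinetic energy are special quadratic first integrals. -/
lemma IsLeviCivita.isSQFI_smul {g : Metric m M} (h : IsLeviCivita D g) (c : ℝ) :
    IsSQFI D (c • kineticEnergy g) := by
  have hp := h.parallel.const_smul g.smooth c
  refine ⟨fun x ↦ c • g.inner x, ⟨g.smooth.const_smul c, fun x v w ↦ ?_, hp.killingType⟩, hp, ?_⟩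
  · simp only [smul_apply, g.symm x v w]
  · rfl

theorem IsRegularFKenmotsu.isSQFI_iff [ConnectedSpace M] (h : IsRegularFKenmotsu S D f)
    (F : TangentBundle (𝓡 m) M → ℝ) : IsSQFI D F ↔ ∃ c : ℝ, F = c • kineticEnergy S.g := by
  constructor
  · rintro ⟨a, ha, hp, rfl⟩
    obtain ⟨c, hc⟩ := h.eq_smul_metric ha.smooth ha.symm hp
    exact ⟨c, funext fun p ↦ hc p.1 p.2 p.2⟩
  · rintro ⟨c, rfl⟩
    exact h.1.leviCivita.isSQFI_smul c

lemma AlmostContactMetric.kineticEnergy_ne_zero [Nonempty M] (S : AlmostContactMetric m M) :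
    kineticEnergy S.g ≠ 0 := by
  intro h
  obtain ⟨x⟩ := (inferInstance : Nonempty M)
  have := congrFun h (TotalSpace.mk' (Model m) x (S.ξ x))
  exact one_ne_zero ((S.inner_ξ_ξ x).symm.trans this)

theorem IsRegularFKenmotsu.admitsSQFI_iff [ConnectedSpace M] (h : IsRegularFKenmotsu S D f)
    (N : ℕ) : AdmitsSQFI D N ↔ N ≤ 1 := by
  constructor
  · rintro ⟨F, hF, hli⟩
    have hspan : ∀ i, F i ∈ Submodule.span ℝ {kineticEnergy S.g} := fun i ↦ by
      obtain ⟨c, hc⟩ := (h.isSQFI_iff _).1 (hF i)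
      exact Submodule.mem_span_singleton.2 ⟨c, hc.symm⟩
    -- An independent family inside a line has at most one member.
    have hle := (LinearIndependent.of_comp (Submodule.subtype _)
      (v := fun i ↦ (⟨F i, hspan i⟩ : Submodule.span ℝ {kineticEnergy S.g}))
      hli).fintype_card_le_finrank
    rw [finrank_span_singleton S.kineticEnergy_ne_zero, Fintype.card_fin] at hle
    exact hle
  · intro hN
    -- For N ≤ 1 independence only asks that the members be nonzero, which also covers the empty
    -- family.
    have : Subsingleton (Fin N) := Fin.subsingleton_iff_le_one.2 hN
    exact ⟨fun _ ↦ kineticEnergy S.g, fun _ ↦ (h.isSQFI_iff _).2 ⟨1, (one_smul _ _).symm⟩,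
      (linearIndependent_subsingleton_index_iff _).2 fun _ ↦ S.kineticEnergy_ne_zero⟩

/-- For n ≥ 1 the natural subtraction does not truncate and n(2n-1) is positive. -/
theorem IsRegularFKenmotsu.not_admitsSQFI [ConnectedSpace M] (h : IsRegularFKenmotsu S D f)
    {n : ℕ} (hn : 1 ≤ n) : ¬ AdmitsSQFI D (1 + n * (2 * n - 1)) := by
  rw [h.admitsSQFI_iff, not_le, Nat.lt_add_right_iff_pos]
  exact Nat.mul_pos hn (by omega)

end Kenmotsu

/-! ### Bundle calculus on the model space reduced to ordinary calculus. -/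

section VectorSpace

variable {m : ℕ}

lemma diffAt_iff_differentiableAt {Y : Model m → Model m} {x : Model m} :
    DiffAt (M := Model m) Y x ↔ DifferentiableAt ℝ Y x := by
  refine ⟨fun h ↦ ?_, fun h ↦ ?_⟩
  · exact (((contMDiff_snd_tangentBundle_modelSpace (n := 1) (Model m) 𝓘(ℝ, Model m)
      _).mdifferentiableAt one_ne_zero).comp x h).differentiableAt
  · refine (mdifferentiableAt_totalSpace ..).2 ⟨mdifferentiableAt_id, ?_⟩
    convert! h.mdifferentiableAt with y
    simp

lemma smoothVectorField_of_contDiff {Y : Model m → Model m} (hY : ContDiff ℝ ∞ Y) :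
    SmoothVectorField (M := Model m) Y :=
  contMDiff_vectorSpace_iff_contDiff.2 hY

/-- On a vector space the trivializations of the tangent and hom bundles are the identity, so a
smooth section is an ordinary smooth map. The same reason serves the next two lemmas. -/
lemma smoothOneForm_of_contDiff {η : (x : Model m) → Tan m x →L[ℝ] ℝ}
    (hη : ContDiff ℝ ∞ (F := Model m →L[ℝ] ℝ) η) :
    SmoothOneForm (M := Model m) η := by
  intro x
  rw [contMDiffAt_section]
  refine ContMDiffAt.congr_of_eventuallyEq (hη.contMDiff x) (.of_forall fun y ↦ ?_)
  refine ContinuousLinearMap.ext fun v ↦ ?_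
  simp [hom_trivializationAt_apply, ContinuousLinearMap.inCoordinates]
  rfl

lemma smoothEndomorphism_of_contDiff {φ : (x : Model m) → Tan m x →L[ℝ] Tan m x}
    (hφ : ContDiff ℝ ∞ (F := Model m →L[ℝ] Model m) φ) : SmoothEndomorphism (M := Model m) φ := by
  intro x
  rw [contMDiffAt_section]
  refine ContMDiffAt.congr_of_eventuallyEq (hφ.contMDiff x) (.of_forall fun y ↦ ?_)
  refine ContinuousLinearMap.ext fun v ↦ ?_
  simp [hom_trivializationAt_apply, ContinuousLinearMap.inCoordinates]
  rfl

lemma smoothTwoTensor_of_contDiff {a : (x : Model m) → Tan m x →L[ℝ] Tan m x →L[ℝ] ℝ}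
    (ha : ContDiff ℝ ∞ (F := Model m →L[ℝ] Model m →L[ℝ] ℝ) a) : SmoothTwoTensor (M := Model m) a := by
  intro x
  rw [contMDiffAt_section]
  refine ContMDiffAt.congr_of_eventuallyEq (ha.contMDiff x) (.of_forall fun y ↦ ?_)
  refine ContinuousLinearMap.ext fun v ↦ ?_
  simp [hom_trivializationAt_apply, ContinuousLinearMap.inCoordinates]
  -- The fibres are iterated hom spaces, so the trivialization has to be unwound a second time.
  refine ContinuousLinearMap.ext fun w ↦ ?_
  rw [Trivialization.linearMapAt_apply, if_pos (by simp; exact Set.mem_univ y)]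
  simp [hom_trivializationAt_apply, ContinuousLinearMap.inCoordinates]
  rfl

lemma mvfderiv_eq_fderiv (h : Model m → ℝ) (x : Model m) :
    mvfderiv (𝓡 m) h x = fderiv ℝ h x := by
  ext v
  rw [← mfderiv_eq_fderiv]
  rfl

/-- The flat connection of a vector space. -/
noncomputable def flatConnection (m : ℕ) : Connection m (Model m) where
  toFun Y x := fderiv ℝ (F := Model m) Y x
  isCovariantDerivativeOnUniv :=
    { add := fun hY hZ _ ↦ fderiv_add (diffAt_iff_differentiableAt.1 hY)
        (diffAt_iff_differentiableAt.1 hZ)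
      leibniz := fun {Y h x} hY hh _ ↦ by
        rw [mvfderiv_eq_fderiv]
        exact fderiv_smul hh.differentiableAt (diffAt_iff_differentiableAt.1 hY) }

lemma mlieBracket_eq (X Y : (x : Model m) → Tan m x) (x : Model m) :
    mlieBracket (𝓡 m) X Y x = lieBracket ℝ (E := Model m) X Y x := by
  rw [← mlieBracketWithin_univ, mlieBracketWithin_eq_lieBracketWithin]
  exact congrFun (lieBracketWithin_univ (E := Model m)) x

end VectorSpace

open scoped RealInnerProductSpace

/-! ### Linear almost contact structures. -/

section WarpedProduct

/-- A linear almost contact metric structure: a unit vector together with an orthogonal complex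
structure on its orthogonal complement. -/
structure LinearContact (E : Type*) [NormedAddCommGroup E] [InnerProductSpace ℝ E] where
  e : E
  J : E →L[ℝ] E
  norm_e : ‖e‖ = 1
  J_e : J e = 0
  inner_e_J : ∀ v, ⟪e, J v⟫ = 0
  J_J : ∀ v, J (J v) = -v + ⟪e, v⟫ • e
  inner_J_J : ∀ v w, ⟪J v, J w⟫ = ⟪v, w⟫ - ⟪e, v⟫ * ⟪e, w⟫

namespace LinearContact

variable {E : Type*} [NormedAddCommGroup E] [InnerProductSpace ℝ E] (L : LinearContact E)

lemma inner_e_e : ⟪L.e, L.e⟫ = 1 := by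
  rw [real_inner_self_eq_norm_sq, L.norm_e, one_pow]

/-- Skew-adjointness: replace w by Jw in `inner_J_J` and use the formula for J². -/
lemma inner_J_right (v w : E) : ⟪v, L.J w⟫ = -⟪L.J v, w⟫ := by
  have h := L.inner_J_J v (L.J w)
  rw [L.J_J, L.inner_e_J, inner_add_right, inner_neg_right, inner_smul_right,
    real_inner_comm, real_inner_comm w, real_inner_comm L.e (L.J v), L.inner_e_J] at h
  rw [real_inner_comm w]
  linarith

lemma sq_inner_le (v : E) : ⟪L.e, v⟫ * ⟪L.e, v⟫ ≤ ⟪v, v⟫ := by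
  have := real_inner_mul_inner_self_le L.e v
  rwa [L.inner_e_e, one_mul] at this

/-- The conjugate structure by a linear isometry. -/
noncomputable def map {F : Type*} [NormedAddCommGroup F] [InnerProductSpace ℝ F] (L : LinearContact E)
    (i : E ≃ₗᵢ[ℝ] F) : LinearContact F where
  e := i L.e
  J := (i : E →L[ℝ] F) ∘L L.J ∘L (i.symm : F →L[ℝ] E)
  norm_e := by simp [L.norm_e]
  J_e := by simp [L.J_e]
  inner_e_J v := by simp [L.inner_e_J]
  J_J v := by
    obtain ⟨v, rfl⟩ := i.surjective v
    simp [L.J_J]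
  inner_J_J v w := by
    obtain ⟨v, rfl⟩ := i.surjective v
    obtain ⟨w, rfl⟩ := i.surjective w
    simp [L.inner_J_J]

lemma withLp_prod_ext {V : Type*} {u v : WithLp 2 (ℝ × WithLp 2 (V × V))} (h₁ : u.fst = v.fst)
    (h₂ : u.snd.fst = v.snd.fst) (h₃ : u.snd.snd = v.snd.snd) : u = v :=
  WithLp.ofLp_injective 2 (Prod.ext h₁ (WithLp.ofLp_injective 2 (Prod.ext h₂ h₃)))

/-- The standard structure on `ℝ × V × V`. -/
noncomputable def standard (V : Type*) [NormedAddCommGroup V] [InnerProductSpace ℝ V] :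
    LinearContact (WithLp 2 (ℝ × WithLp 2 (V × V))) where
  e := WithLp.toLp 2 (1, 0)
  -- J drops the ℝ-coordinate and makes a quarter turn in V × V, so it has norm bound 1.
  J := LinearMap.mkContinuous
    { toFun := fun v ↦ WithLp.toLp 2 (0, WithLp.toLp 2 (-v.snd.snd, v.snd.fst))
      map_add' := fun v w ↦ by
        apply withLp_prod_ext <;> simp
        abel
      map_smul' := fun c v ↦ by apply withLp_prod_ext <;> simp } 1 (fun v ↦ by
        rw [one_mul]
        refine le_of_sq_le_sq ?_ (norm_nonneg _)
        simp [WithLp.prod_norm_sq_eq_of_L2]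
        nlinarith [sq_nonneg v.fst])
  norm_e := by
    simp
  J_e := by apply withLp_prod_ext <;> simp
  inner_e_J v := by simp
  J_J v := by apply withLp_prod_ext <;> simp
  inner_J_J v w := by
    simp
    ring

/-- With dim V = n, an orthonormal basis of ℝ × V × V transports the standard structure to the
model. -/
lemma nonempty_model (n : ℕ) : Nonempty (LinearContact (Model (2 * n + 1))) := by
  let V := EuclideanSpace ℝ (Fin n)
  have h : Module.finrank ℝ (WithLp 2 (ℝ × WithLp 2 (V × V))) = 2 * n + 1 := by
    rw [(WithLp.linearEquiv 2 ℝ (ℝ × WithLp 2 (V × V))).finrank_eq, Module.finrank_prod,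
      (WithLp.linearEquiv 2 ℝ (V × V)).finrank_eq, Module.finrank_prod]
    simp [V]
    ring
  exact ⟨(standard V).map (((stdOrthonormalBasis ℝ _).reindex (finCongr h)).repr)⟩

end LinearContact

end WarpedProduct

open scoped RealInnerProductSpace

/-! ### The warped product example. -/

section WarpedProduct

lemma contDiff_const_add_exp_smul {E F : Type*} [NormedAddCommGroup E] [NormedSpace ℝ E]
    [NormedAddCommGroup F] [NormedSpace ℝ F] (l : E →L[ℝ] ℝ) (a b : F) :
    ContDiff ℝ ∞ fun x ↦ a + Real.exp (2 * l x) • b :=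
  contDiff_const.add ((contDiff_const.mul l.contDiff).exp.smul contDiff_const)

namespace LinearContact

variable {m : ℕ} (L : LinearContact (Model m))

/-- The linear form dual to the unit vector. -/
noncomputable def η : Model m →L[ℝ] ℝ := innerSL ℝ L.e

lemma η_apply (v : Model m) : L.η v = ⟪L.e, v⟫ := rfl

lemma η_e : L.η L.e = 1 := L.inner_e_e

lemma η_J (v : Model m) : L.η (L.J v) = 0 := L.inner_e_J v

/-- The inner product of the components orthogonal to the unit vector. -/
noncomputable def horizontal : Model m →L[ℝ] Model m →L[ℝ] ℝ :=
  let B : Model m →L[ℝ] Model m →L[ℝ] ℝ := innerSL ℝ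
  B - L.η.smulRight L.η

lemma horizontal_apply (v w : Model m) : L.horizontal v w = ⟪v, w⟫ - L.η v * L.η w := rfl

lemma horizontal_comm (v w : Model m) : L.horizontal v w = L.horizontal w v := by
  rw [horizontal_apply, horizontal_apply, real_inner_comm, mul_comm]

lemma horizontal_self_nonneg (v : Model m) : 0 ≤ L.horizontal v v :=
  sub_nonneg.2 (L.sq_inner_le v)

lemma horizontal_J_J (v w : Model m) : L.horizontal (L.J v) (L.J w) = L.horizontal v w := by
  rw [horizontal_apply, L.inner_J_J, η_J, zero_mul, sub_zero]
  rfl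

lemma horizontal_e (v : Model m) : L.horizontal v L.e = 0 := by
  rw [horizontal_apply, η_e, mul_one, η_apply, real_inner_comm, sub_self]

lemma horizontal_J_right (v w : Model m) :
    L.horizontal v (L.J w) = -L.horizontal (L.J v) w := by
  rw [horizontal_apply, horizontal_apply, L.inner_J_right, η_J, η_J]
  ring

/-- The warped product metric `η² + e^{2η} (⟪·,·⟫ - η²)`. -/
noncomputable def warpedInner (x : Model m) : Model m →L[ℝ] Model m →L[ℝ] ℝ :=
  L.η.smulRight L.η + Real.exp (2 * L.η x) • L.horizontal

lemma warpedInner_apply (x v w : Model m) :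
    L.warpedInner x v w = L.η v * L.η w + Real.exp (2 * L.η x) * L.horizontal v w := rfl

lemma warpedInner_comm (x v w : Model m) : L.warpedInner x v w = L.warpedInner x w v := by
  rw [warpedInner_apply, warpedInner_apply, L.horizontal_comm v w, mul_comm (L.η v)]

lemma η_eq_warpedInner (x v : Model m) : L.η v = L.warpedInner x v L.e := by
  rw [warpedInner_apply, η_e, horizontal_e, mul_zero, add_zero, mul_one]

lemma warpedInner_J_J (x v w : Model m) :
    L.warpedInner x (L.J v) (L.J w) = L.warpedInner x v w - L.η v * L.η w := by
  rw [warpedInner_apply, warpedInner_apply, horizontal_J_J, η_J]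
  ring

/-- The metric weighs the e-direction by 1 and its complement by e^{2η}, so the smaller weight is a
lower bound. Positivity and boundedness of the unit ball both follow. -/
lemma exists_norm_sq_le_warpedInner (x : Model m) :
    ∃ c : ℝ, 0 < c ∧ ∀ v, c * ‖v‖ ^ 2 ≤ L.warpedInner x v v := by
  refine ⟨min 1 (Real.exp (2 * L.η x)), lt_min one_pos (Real.exp_pos _), fun v ↦ ?_⟩
  have h : ‖v‖ ^ 2 = L.η v * L.η v + L.horizontal v v := by
    rw [horizontal_apply, real_inner_self_eq_norm_sq]
    ring
  rw [h, mul_add, warpedInner_apply]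
  have h1 := mul_le_mul_of_nonneg_right (min_le_left 1 (Real.exp (2 * L.η x)))
    (mul_self_nonneg (L.η v))
  have h2 := mul_le_mul_of_nonneg_right (min_le_right 1 (Real.exp (2 * L.η x)))
    (L.horizontal_self_nonneg v)
  linarith

lemma warpedInner_pos (x v : Model m) (hv : v ≠ 0) : 0 < L.warpedInner x v v := by
  obtain ⟨c, hc, h⟩ := L.exists_norm_sq_le_warpedInner x
  exact (mul_pos hc (pow_pos (norm_pos_iff.2 hv) 2)).trans_le (h v)

lemma isVonNBounded_warpedInner (x : Model m) :
    Bornology.IsVonNBounded ℝ {v : Model m | L.warpedInner x v v < 1} := by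
  obtain ⟨c, hc, h⟩ := L.exists_norm_sq_le_warpedInner x
  -- The radius 1 + c⁻¹ avoids a square root: 2‖v‖ ≤ 1 + ‖v‖² < 1 + c⁻¹.
  refine (NormedSpace.isVonNBounded_closedBall ℝ (Model m) (1 + c⁻¹)).subset fun v hv ↦ ?_
  rw [mem_closedBall_zero_iff]
  have h1 : ‖v‖ ^ 2 < c⁻¹ := by
    rw [← one_div, lt_div_iff₀' hc]
    exact (h v).trans_lt hv
  have := inv_pos.2 hc
  nlinarith [sq_nonneg (‖v‖ - 1), norm_nonneg v]

lemma contDiff_warpedInner : ContDiff ℝ ∞ L.warpedInner :=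
  contDiff_const_add_exp_smul L.η _ _

/-- The warped product metric as a Riemannian metric on the model space. -/
noncomputable def metric : Metric m (Model m) where
  inner := L.warpedInner
  symm := L.warpedInner_comm
  pos := L.warpedInner_pos
  isVonNBounded := L.isVonNBounded_warpedInner
  contMDiff := smoothTwoTensor_of_contDiff L.contDiff_warpedInner

/-- The almost contact metric structure of the warped product metric. -/
noncomputable def almostContactMetric : AlmostContactMetric m (Model m) where
  φ _ := L.J
  ξ _ := L.e
  η _ := L.η
  g := L.metric
  smooth_φ := smoothEndomorphism_of_contDiff contDiff_const
  smooth_ξ := smoothVectorField_of_contDiff contDiff_const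
  smooth_η := smoothOneForm_of_contDiff contDiff_const
  φ_sq _ v := L.J_J v
  η_ξ _ := L.η_e
  η_φ _ v := L.η_J v
  φ_ξ _ := L.J_e
  η_eq := L.η_eq_warpedInner
  g_φ := L.warpedInner_J_J

/-- The Christoffel form of the warped product metric. -/
noncomputable def christoffel (x : Model m) : Model m →L[ℝ] Model m →L[ℝ] Model m :=
  (ContinuousLinearMap.smulRightL ℝ (Model m) (Model m)).flip L.e ∘L
      (-(Real.exp (2 * L.η x) • L.horizontal) - (2 : ℝ) • L.η.smulRight L.η)
    + L.η.smulRight (ContinuousLinearMap.id ℝ (Model m))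
    + ContinuousLinearMap.smulRightL ℝ (Model m) (Model m) L.η

/-- With v', w' the components orthogonal to e, this is -e^{2η}⟪v',w'⟫e + η(v)w' + η(w)v'; the term
-2η(v)η(w)e comes from the two projections. -/
lemma christoffel_apply (x v w : Model m) :
    L.christoffel x v w = (-(Real.exp (2 * L.η x) * L.horizontal v w) - 2 * (L.η v * L.η w)) • L.e
      + L.η v • w + L.η w • v := rfl

lemma christoffel_comm (x v w : Model m) : L.christoffel x v w = L.christoffel x w v := by
  rw [christoffel_apply, christoffel_apply, L.horizontal_comm v w]
  module

/-- The covariant derivative of the warped product metric. -/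
noncomputable def nabla (Y : Model m → Model m) (x v : Model m) : Model m :=
  fderiv ℝ Y x v + L.christoffel x (Y x) v

/-- The Levi-Civita connection of the warped product metric. -/
noncomputable def connection : Connection m (Model m) :=
  (flatConnection m).addOneForm L.christoffel

/-- The symmetric Christoffel terms cancel, leaving the torsion-free flat connection. -/
lemma nabla_sub_nabla (X Y : Model m → Model m) (x : Model m) :
    L.nabla Y x (X x) - L.nabla X x (Y x) = lieBracket ℝ X Y x := by
  rw [nabla, nabla, L.christoffel_comm x (Y x), lieBracket_eq]
  exact add_sub_add_right_eq_sub _ _ _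

lemma connection_torsion : L.connection.torsion = 0 := by
  refine L.connection.torsion_eq_zero_iff.2 fun {X Y x} _ _ ↦ ?_
  rw [mlieBracket_eq]
  exact L.nabla_sub_nabla X Y x

/-- The product rule for the warped product metric. -/
lemma fderiv_warpedInner {Y Z : Model m → Model m} {x : Model m}
    (hY : DifferentiableAt ℝ Y x) (hZ : DifferentiableAt ℝ Z x) (v : Model m) :
    fderiv ℝ (fun y ↦ L.warpedInner y (Y y) (Z y)) x v =
      L.warpedInner x (L.nabla Y x v) (Z x) + L.warpedInner x (Y x) (L.nabla Z x v) := by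
  have dY := (L.η.hasFDerivAt (x := Y x)).comp x hY.hasFDerivAt
  have dZ := (L.η.hasFDerivAt (x := Z x)).comp x hZ.hasFDerivAt
  have dh := L.horizontal.hasFDerivAt_of_bilinear hY.hasFDerivAt hZ.hasFDerivAt
  have de := ((L.η.hasFDerivAt (x := x)).const_mul 2).exp
  have e : fderiv ℝ (fun y ↦ L.warpedInner y (Y y) (Z y)) x = _ :=
    ((dY.mul dZ).add (de.mul dh)).fderiv
  rw [e]
  -- Of the Christoffel terms only 2η(v)e^{2η} times the horizontal product survives, which is the
  -- derivative of the warping factor.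
  simp only [nabla, christoffel_apply, warpedInner_apply, add_apply, smul_apply,
    smul_eq_mul, map_add, map_smul, Function.comp_apply, ContinuousLinearMap.comp_apply,
    ContinuousLinearMap.precompR_apply, ContinuousLinearMap.compL_apply, ContinuousLinearMap.precompL_apply, η_e, horizontal_e,
    L.horizontal_comm L.e, L.horizontal_comm v]
  ring

lemma connection_isLeviCivita : IsLeviCivita L.connection L.metric := by
  refine ⟨L.connection_torsion, ?_⟩
  let : RiemannianBundle (fun x : Model m ↦ TangentSpace (𝓡 m) x) := ⟨L.metric.toRiemannianMetric⟩
  refine (CovariantDerivative.isMetricCompatible_iff _).2 fun {x X Y Z} _ hY hZ ↦ ?_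
  have := L.fderiv_warpedInner (diffAt_iff_differentiableAt.1 hY)
    (diffAt_iff_differentiableAt.1 hZ) (X x)
  rw [mvfderiv_eq_fderiv]
  exact this

/-- J is constant, so only Christoffel terms contribute. The factor 1 is the value of f. -/
lemma nabla_J {Y : Model m → Model m} {x : Model m} (hY : DifferentiableAt ℝ Y x)
    (v : Model m) :
    L.nabla (fun y ↦ L.J (Y y)) x v - L.J (L.nabla Y x v) =
      (1 : ℝ) • (L.warpedInner x (L.J v) (Y x) • L.e - L.η (Y x) • L.J v) := by
  have h : fderiv ℝ (fun y ↦ L.J (Y y)) x = L.J ∘L fderiv ℝ Y x :=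
    (L.J.hasFDerivAt.comp x hY.hasFDerivAt).fderiv
  rw [nabla, nabla, h, christoffel_apply, christoffel_apply,
    warpedInner_apply, η_J, L.horizontal_comm _ v, horizontal_J_right]
  simp only [map_add, map_smul, L.J_e, η_J, ContinuousLinearMap.comp_apply]
  module

lemma connection_isRegularFKenmotsu :
    IsRegularFKenmotsu L.almostContactMetric L.connection (fun _ ↦ 1) := by
  refine ⟨⟨L.connection_isLeviCivita, contMDiff_const, fun _ ↦ one_pos, fun x v w ↦ ?_,
    fun x v Y hY ↦ L.nabla_J (diffAt_iff_differentiableAt.1 hY) v⟩, fun x ↦ ?_⟩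
  · simp [mvfderiv_const]
  · simp [mvfderiv_const]

end LinearContact

end WarpedProduct

end AlmostContact

theorem proposition5 :
    (∀ n : ℕ, 1 ≤ n →
      ∃ (M : Type) (_ : TopologicalSpace M)
        (_ : ChartedSpace (AlmostContact.Model (2 * n + 1)) M)
        (_ : IsManifold (𝓡 (2 * n + 1)) ∞ M)
        (_ : T2Space M) (_ : SecondCountableTopology M) (_ : ConnectedSpace M)
        (S : AlmostContact.AlmostContactMetric (2 * n + 1) M)
        (D : AlmostContact.Connection (2 * n + 1) M) (f : M → ℝ),
        AlmostContact.IsRegularFKenmotsu S D f ∧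
        ¬ AlmostContact.AdmitsSQFI D (1 + n * (2 * n - 1))) ∧
    (∀ (n : ℕ) (M : Type*) [TopologicalSpace M]
        [ChartedSpace (AlmostContact.Model (2 * n + 1)) M]
        [IsManifold (𝓡 (2 * n + 1)) ∞ M]
        [T2Space M] [SecondCountableTopology M] [ConnectedSpace M]
        (S : AlmostContact.AlmostContactMetric (2 * n + 1) M)
        (D : AlmostContact.Connection (2 * n + 1) M) (f : M → ℝ),
        AlmostContact.IsRegularFKenmotsu S D f →
        (∀ F : TangentBundle (𝓡 (2 * n + 1)) M → ℝ, AlmostContact.IsSQFI D F ↔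
          ∃ c : ℝ, F = c • AlmostContact.kineticEnergy S.g) ∧
        (∀ N : ℕ, AlmostContact.AdmitsSQFI D N ↔ N ≤ 1) ∧
        (1 ≤ n → ¬ AlmostContact.AdmitsSQFI D (1 + n * (2 * n - 1)))) := by
  refine ⟨fun n hn ↦ ?_, fun n M _ _ _ _ _ _ S D f h ↦
    ⟨h.isSQFI_iff, h.admitsSQFI_iff, h.not_admitsSQFI⟩⟩
  obtain ⟨L⟩ := AlmostContact.LinearContact.nonempty_model n
  exact ⟨AlmostContact.Model (2 * n + 1), inferInstance, inferInstance, inferInstance,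
    inferInstance, inferInstance, inferInstance, L.almostContactMetric, L.connection, fun _ ↦ 1,
    L.connection_isRegularFKenmotsu, L.connection_isRegularFKenmotsu.not_admitsSQFI hn⟩
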